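/- For a space $Y$, let $C_p(Y)$ be the set $C(Y)$ of all continuous real-valued functions on $Y$, endowed with the pointwise topology (the topology induced from $\mathbb{R}^Y$). A space $X$ is closely embedded into $Z$ if there is an embedding $X\to Z$ whose image is closed in $Z$. A Tychonoff space $X$ is realcompact if it is not a proper dense subspace of any Tychonoff space to which every continuous function $X\to\mathbb{R}$ extends continuously. A space $Y$ has countable tightness if whenever $a\in\overline{A}$ for some $A\subseteq Y$, there is a countable $A_0\subseteq A$ with $a\in\overline{A_0}$. **Proposition.** For a Tychonoff space $X$, the following assertions are equivalent: (i) $X$ is realcompact; (ii) $X$ is closely embedded into $C_p(Y)$ for some discrete space $Y$; (iii) $X$ is closely embedded into $C_p(Y)$ for some metrizable space $Y$; (iv) $X$ is closely embedded into $C_p(Y)$ for some Tychonoff Fréchet–Urysohn space $Y$; (v) $X$ is closely embedded into $C_p(Y)$ for some Tychonoff sequential space $Y$; (vi) $X$ is closely embedded into $C_p(Y)$ for some Tychonoff space $Y$ with countable tightness. -/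

import Mathlib

universe u v

/-- `Cp Y` is the set `C(Y, ℝ)` of all continuous real-valued functions on `Y`, as a type of its
own, so that it does not inherit the compact-open topology of `C(Y, ℝ)`. -/
def Cp (Y : Type u) [TopologicalSpace Y] : Type u := C(Y, ℝ)

/-- The underlying function of an element of `Cp Y`. -/
def Cp.toFun {Y : Type u} [TopologicalSpace Y] (f : Cp Y) : Y → ℝ :=
  (show C(Y, ℝ) from f : C(Y, ℝ))

/-- The pointwise topology on `Cp Y`, i.e. the topology induced from the product `ℝ ^ Y`. -/
instance Cp.instTopologicalSpace (Y : Type u) [TopologicalSpace Y] : TopologicalSpace (Cp Y) :=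
  TopologicalSpace.induced Cp.toFun Pi.topologicalSpace

/-- `X` is closely embedded into `Z`: there is an embedding of `X` into `Z` with closed image. -/
def CloselyEmbedded (X : Type u) (Z : Type v) [TopologicalSpace X] [TopologicalSpace Z] : Prop :=
  ∃ φ : X → Z, Topology.IsClosedEmbedding φ

/-- A realcompact space (Hewitt, Engelking): a Tychonoff space `X` that is not a proper dense
subspace of a Tychonoff space `Z` to which every continuous real-valued function on `X` extends
continuously. A Tychonoff space in which `X` is dense has at most `2 ^ (2 ^ #X)` points, so
it suffices to let `Z` range over the universe of `X`. -/
structure IsRealcompact (X : Type u) [TopologicalSpace X] : Prop where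
  t35Space : T35Space X
  surjective_of_extends : ∀ (Z : Type u) [TopologicalSpace Z] [T35Space Z] (r : X → Z),
    IsDenseEmbedding r → (∀ f : C(X, ℝ), ∃ g : C(Z, ℝ), ∀ x : X, g (r x) = f x) →
    Function.Surjective r

/-- `Y` has countable tightness: a point in the closure of a set `A` is in the closure of some
countable subset of `A`. -/
def CountablyTight (Y : Type u) [TopologicalSpace Y] : Prop :=
  ∀ (A : Set Y) (a : Y), a ∈ closure A → ∃ A₀ : Set Y, A₀ ⊆ A ∧ A₀.Countable ∧ a ∈ closure A₀

open Topology Set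

/-! Every `f` in `C(X, ℝ)` extends to the closure of the evaluation image of `X` in `ℝ ^ C(X, ℝ)`,
as the `f`-th projection; so if `X` is realcompact the image is closed, and this power is `Cp` of a
discrete space. Conversely, let `φ` embed `X` as a closed subset of `Cp Y`, with `Y` countably
tight, and let `X` be dense in `Z` with all real functions extending. The coordinates of `φ` extend
to functions `g y` on `Z`. By `exists_forall_eq_of_extends`, on countably many `y` the values `g y
z` agree with those of some `φ x`, so tightness makes `y ↦ g y z` continuous. Thus `φ` extends to `Z
→ Cp Y`; its values stay in the closed image of `X`, which forces `Z = X`. -/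

theorem Cp.isInducing_toFun (Y : Type u) [TopologicalSpace Y] :
    IsInducing (Cp.toFun : Cp Y → Y → ℝ) := ⟨rfl⟩

theorem Cp.continuous_toFun {Y : Type u} [TopologicalSpace Y] (f : Cp Y) :
    Continuous f.toFun :=
  ContinuousMap.continuous f

theorem Cp.isEmbedding_toFun (Y : Type u) [TopologicalSpace Y] :
    IsEmbedding (Cp.toFun : Cp Y → Y → ℝ) :=
  ⟨Cp.isInducing_toFun Y, fun _ _ h => ContinuousMap.ext (congrFun h)⟩

/-- Evaluation embeds a Tychonoff space into the product of lines indexed by its continuous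
real-valued functions. -/
theorem isEmbedding_eval_continuousMap (X : Type u) [TopologicalSpace X] [T35Space X] :
    IsEmbedding (fun (x : X) (f : C(X, ℝ)) => f x) := by
  have hc : Continuous (fun (x : X) (f : C(X, ℝ)) => f x) :=
    continuous_pi fun f => f.continuous
  have hind : IsInducing (fun (x : X) (f : C(X, ℝ)) => f x) := by
    refine isInducing_iff_nhds.2 fun x => le_antisymm (hc.tendsto x).le_comap ?_
    intro s hs
    obtain ⟨U, hUs, hU, hxU⟩ := mem_nhds_iff.1 hs
    obtain ⟨f, hf, hfx, hfU⟩ :=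
      CompletelyRegularSpace.completely_regular x Uᶜ hU.isClosed_compl (fun h => h hxU)
    let F : C(X, ℝ) := ⟨fun a => (f a : ℝ), by fun_prop⟩
    refine Filter.mem_comap.2 ⟨{p | p F < 1}, ?_, ?_⟩
    · refine (isOpen_lt (continuous_apply F) continuous_const).mem_nhds ?_
      simp [F, hfx]
    · intro a ha
      by_contra hna
      have h1 : f a = 1 := hfU (fun h => hna (hUs h))
      simp [F, h1] at ha
  exact ⟨hind, hind.injective⟩

theorem IsRealcompact.isClosedEmbedding_eval {X : Type u} [TopologicalSpace X] [T35Space X]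
    (h : IsRealcompact X) : IsClosedEmbedding (fun (x : X) (f : C(X, ℝ)) => f x) := by
  set e : X → C(X, ℝ) → ℝ := fun x f => f x
  have he : IsEmbedding e := isEmbedding_eval_continuousMap X
  let r : X → closure (range e) := fun x => ⟨e x, subset_closure (mem_range_self x)⟩
  have hr : IsEmbedding r := he.codRestrict (closure (range e)) _
  have hd : DenseRange r := by
    intro z
    rw [closure_subtype, ← range_comp]
    exact z.2
  have hs := h.surjective_of_extends (closure (range e)) r ⟨⟨hr.isInducing, hd⟩, hr.injective⟩
    fun f => ⟨⟨fun z => z.1 f, (continuous_apply f).comp continuous_subtype_val⟩, fun _ => rfl⟩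
  refine ⟨he, isClosed_of_closure_subset fun p hp => ?_⟩
  obtain ⟨x, hx⟩ := hs ⟨p, hp⟩
  exact ⟨x, congrArg Subtype.val hx⟩

theorem IsRealcompact.exists_discrete {X : Type u} [TopologicalSpace X] [T35Space X]
    (h : IsRealcompact X) : ∃ (Y : Type (max u v)) (_ : TopologicalSpace Y),
      T35Space Y ∧ DiscreteTopology Y ∧ CloselyEmbedded X (Cp Y) := by
  -- `ULift` only moves the index set to the larger universe.
  let _ : TopologicalSpace (ULift.{v} C(X, ℝ)) := ⊥
  have : DiscreteTopology (ULift.{v} C(X, ℝ)) := ⟨rfl⟩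
  refine ⟨ULift.{v} C(X, ℝ), inferInstance, inferInstance, inferInstance, ?_⟩
  have hreindex : IsClosedEmbedding
      (fun (x : X) (f : ULift.{v} C(X, ℝ)) => f.down x) :=
    (Homeomorph.piCongrLeft (Y := fun _ => ℝ)
      (Equiv.ulift.{v, u} (α := C(X, ℝ))).symm).isClosedEmbedding.comp h.isClosedEmbedding_eval
  let φ : X → Cp (ULift.{v} C(X, ℝ)) :=
    fun x => (⟨fun f => f.down x, continuous_of_discreteTopology⟩ : C(ULift.{v} C(X, ℝ), ℝ))
  have hT := Cp.isEmbedding_toFun (ULift.{v} C(X, ℝ))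
  have hφ : Cp.toFun ∘ φ = fun (x : X) (f : ULift.{v} C(X, ℝ)) => f.down x := rfl
  refine ⟨φ, hT.of_comp_iff.1 (hφ ▸ hreindex.isEmbedding), ?_⟩
  have hrange : range φ = Cp.toFun ⁻¹' range (Cp.toFun ∘ φ) := by
    rw [range_comp, preimage_image_eq _ hT.injective]
  rw [hrange, hφ]
  exact hreindex.isClosed_range.preimage hT.continuous

/-- The points reached from countable subsets of `A` form a sequentially closed set, since a
countable union of countable sets is countable. -/
theorem SequentialSpace.countablyTight (Y : Type u) [TopologicalSpace Y] [SequentialSpace Y] :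
    CountablyTight Y := by
  intro A a ha
  set S : Set Y := {b | ∃ A₀ : Set Y, A₀ ⊆ A ∧ A₀.Countable ∧ b ∈ closure A₀}
  have hS : IsSeqClosed S := by
    intro x p hx hp
    choose B hBA hBc hB using hx
    refine ⟨⋃ n, B n, iUnion_subset hBA, countable_iUnion hBc, ?_⟩
    exact isClosed_closure.isSeqClosed
      (fun n => closure_mono (subset_iUnion B n) (hB n)) hp
  have hAS : A ⊆ S := fun b hb =>
    ⟨{b}, singleton_subset_iff.2 hb, countable_singleton b, subset_closure rfl⟩
  exact closure_minimal hAS hS.isClosed ha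

/-- A dense subspace to which continuous real functions are restricted surjectively meets every
zero-set, hence every countable intersection of fibres of continuous functions. -/
theorem exists_forall_eq_of_extends {X Z : Type*} [TopologicalSpace X] [TopologicalSpace Z]
    {r : X → Z} (hr : Continuous r) (hd : DenseRange r)
    (hext : ∀ f : C(X, ℝ), ∃ g : C(Z, ℝ), ∀ x : X, g (r x) = f x)
    (g : ℕ → C(Z, ℝ)) (z : Z) : ∃ x : X, ∀ n, g n (r x) = g n z := by
  by_contra! hne
  -- The sum `G` of these terms vanishes exactly where all `g n` take their values at `z`. If `G`
  -- had no zero on `X`, then `1 / G` would extend to some `k` with `k * G = 1` on `Z`, which fails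
  -- at `z`.
  let t : ℕ → Z → ℝ := fun n w => (1 / 2) ^ n * min 1 |g n w - g n z|
  have ht0 : ∀ n w, 0 ≤ t n w := fun n w => by positivity
  have htle : ∀ n w, t n w ≤ (1 / 2) ^ n := fun n w =>
    mul_le_of_le_one_right (by positivity) (min_le_left _ _)
  have hsum : ∀ w, Summable fun n => t n w := fun w =>
    Summable.of_nonneg_of_le (fun n => ht0 n w) (fun n => htle n w) summable_geometric_two
  let G : Z → ℝ := fun w => ∑' n, t n w
  have hG : Continuous G := by
    refine continuous_tsum (fun n => ?_) summable_geometric_two fun n w => ?_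
    · dsimp only [t]
      fun_prop
    · rw [Real.norm_of_nonneg (ht0 n w)]
      exact htle n w
  have hGz : G z = 0 := by simp [G, t]
  have hGr : ∀ x, G (r x) ≠ 0 := by
    intro x
    obtain ⟨n, hn⟩ := hne x
    refine ((hsum (r x)).tsum_pos (fun m => ht0 m _) n ?_).ne'
    exact mul_pos (by positivity) (lt_min one_pos (abs_pos.2 (sub_ne_zero.2 hn)))
  obtain ⟨k, hk⟩ := hext ⟨fun x => (G (r x))⁻¹, (hG.comp hr).inv₀ hGr⟩
  have hone : (fun w => k w * G w) = fun _ => 1 := by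
    refine hd.equalizer (k.continuous.mul hG) continuous_const (funext fun x => ?_)
    simp [hk, hGr x]
  simpa [hGz] using congrFun hone z

theorem CloselyEmbedded.isRealcompact {X : Type u} [TopologicalSpace X] [T35Space X]
    {Y : Type v} [TopologicalSpace Y] (hY : CountablyTight Y)
    (h : CloselyEmbedded X (Cp Y)) : IsRealcompact X := by
  refine ⟨inferInstance, fun Z _ _ r hr hext => ?_⟩
  obtain ⟨φ, hφ⟩ := h
  have hcoord : ∀ y, Continuous fun x => (φ x).toFun y := fun y =>
    (continuous_apply y).comp ((Cp.isInducing_toFun Y).continuous.comp hφ.continuous)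
  choose g hg using fun y => hext ⟨fun x => (φ x).toFun y, hcoord y⟩
  have hcont : ∀ z, Continuous fun y => g y z := by
    intro z
    refine continuous_iff_image_closure_subset_closure_image.2 fun A => ?_
    rintro _ ⟨y, hy, rfl⟩
    obtain ⟨A₀, hA₀, hc, hyA₀⟩ := hY A y hy
    -- Including `y` makes one `x` match `g · z` at `y` as well as on `A₀`, so continuity of `φ x`
    -- carries over.
    obtain ⟨a, ha⟩ := (hc.insert y).exists_eq_range (insert_nonempty y A₀)
    obtain ⟨x, hx⟩ := exists_forall_eq_of_extends hr.continuous hr.dense hext (fun n => g (a n)) z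
    have heq : ∀ b ∈ insert y A₀, (φ x).toFun b = g b z := by
      intro b hb
      obtain ⟨n, rfl⟩ := ha ▸ hb
      exact (hg (a n) x).symm.trans (hx n)
    have himage := image_closure_subset_closure_image (Cp.continuous_toFun (φ x))
      (mem_image_of_mem _ hyA₀)
    rw [heq y (mem_insert _ _), image_congr fun b hb => heq b (mem_insert_of_mem _ hb)] at himage
    exact closure_mono (image_mono hA₀) himage
  let Φ : Z → Cp Y := fun z => (⟨fun y => g y z, hcont z⟩ : C(Y, ℝ))
  have hΦ : Continuous Φ :=
    (Cp.isInducing_toFun Y).continuous_iff.2 (continuous_pi fun y => (g y).continuous)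
  have hΦr : ∀ x, Φ (r x) = φ x := fun x => ContinuousMap.ext fun y => hg y x
  have hmem : ∀ z, Φ z ∈ range φ := fun z =>
    hr.dense.induction_on (p := fun z => Φ z ∈ range φ) z (hφ.isClosed_range.preimage hΦ)
      fun x => ⟨x, (hΦr x).symm⟩
  choose s hs using hmem
  have hsc : Continuous s := hφ.isInducing.continuous_iff.2 (by
    rwa [show φ ∘ s = Φ from funext hs])
  -- `s` retracts `Z` onto `X`; `r ∘ s` fixes the dense image of `r`, hence all of the Hausdorff
  -- space `Z`.
  have hrs : r ∘ s = id := by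
    refine hr.dense.equalizer (hr.continuous.comp hsc) continuous_id (funext fun x => ?_)
    exact congrArg r (hφ.injective ((hs (r x)).trans (hΦr x)))
  exact fun z => ⟨s z, congrFun hrs z⟩

theorem propositionp (X : Type u) [TopologicalSpace X] [T35Space X] :
    List.TFAE [
      IsRealcompact X,
      ∃ (Y : Type (max u v)) (_ : TopologicalSpace Y),
        T35Space Y ∧ DiscreteTopology Y ∧ CloselyEmbedded X (Cp Y),
      ∃ (Y : Type (max u v)) (_ : TopologicalSpace Y),
        T35Space Y ∧ TopologicalSpace.MetrizableSpace Y ∧ CloselyEmbedded X (Cp Y),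
      ∃ (Y : Type (max u v)) (_ : TopologicalSpace Y),
        T35Space Y ∧ FrechetUrysohnSpace Y ∧ CloselyEmbedded X (Cp Y),
      ∃ (Y : Type (max u v)) (_ : TopologicalSpace Y),
        T35Space Y ∧ SequentialSpace Y ∧ CloselyEmbedded X (Cp Y),
      ∃ (Y : Type (max u v)) (_ : TopologicalSpace Y),
        T35Space Y ∧ CountablyTight Y ∧ CloselyEmbedded X (Cp Y)] := by
  tfae_have 1 → 2 := IsRealcompact.exists_discrete
  tfae_have 2 → 3 := fun ⟨Y, _, h, _, hX⟩ => ⟨Y, _, h, inferInstance, hX⟩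
  tfae_have 3 → 4 := fun ⟨Y, _, h, _, hX⟩ => ⟨Y, _, h, inferInstance, hX⟩
  tfae_have 4 → 5 := fun ⟨Y, _, h, _, hX⟩ => ⟨Y, _, h, inferInstance, hX⟩
  tfae_have 5 → 6 := fun ⟨Y, _, h, _, hX⟩ => ⟨Y, _, h, SequentialSpace.countablyTight Y, hX⟩
  tfae_have 6 → 1 := fun ⟨_, _, _, hY, hX⟩ => hX.isRealcompact hY
  tfae_finish
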